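/- For $n\ge 1$, a permutation $\sigma$ of $[n]=\{1,\dots,n\}$ is alternating if $\sigma(1)<\sigma(2)>\sigma(3)<\sigma(4)>\cdots$ (strictly alternating inequalities up to $\sigma(n)$), and it is cyclically alternating if, in addition, $n$ is even and $\sigma(n)>\sigma(1)$. Let $A(n)$ be the number of alternating permutations of $[n]$ and, for even $n$, let $A_0(n)$ be the number of cyclically alternating ones. For $n\ge 2$ let $$S(n)=\sum_{k=-\infty}^{\infty}\frac{1}{(4k+1)^n},$$ which converges absolutely. Then for every integer $m\ge 1$, $$\frac{A_0(2m)}{A(2m)}=m\,\frac{A(2m-1)}{A(2m)}=\frac{\pi}{4}\cdot\frac{S(2m)}{S(2m+1)},$$ and this ratio is the probability $p_m$ that a uniformly random alternating permutation of $[2m]$ is cyclically alternating. As $m\to\infty$ it tends to $\pi/4$, and the error is asymptotically a constant multiple of $3^{-2m}$: there is a constant $c>0$ such that $$p_m-\frac{\pi}{4}\sim c\cdot 3^{-2m}\qquad(m\to\infty).$$ -/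

import Mathlib

open Filter Topology Asymptotics

noncomputable section

namespace AltPerm

/-- `σ(1) < σ(2) > σ(3) < σ(4) > ⋯`. The points of `[n]` are numbered `0, …, n - 1` here, so the
inequality between positions `i` and `i + 1` is `<` when `i` is even and `>` when `i` is odd. -/
def IsAlternating {n : ℕ} (σ : Equiv.Perm (Fin n)) : Prop :=
  ∀ (i : ℕ) (h : i + 1 < n),
    (Even i → σ ⟨i, Nat.lt_of_succ_lt h⟩ < σ ⟨i + 1, h⟩) ∧
    (Odd i → σ ⟨i + 1, h⟩ < σ ⟨i, Nat.lt_of_succ_lt h⟩)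

/-- An alternating permutation of `[n]` with `n` even and `σ(n) > σ(1)`. -/
def IsCyclicallyAlternating {n : ℕ} (σ : Equiv.Perm (Fin n)) : Prop :=
  IsAlternating σ ∧ Even n ∧
    ∀ h : 0 < n, σ ⟨0, h⟩ < σ ⟨n - 1, Nat.sub_lt h Nat.one_pos⟩

/-- The number `A(n)` of alternating permutations of `[n]`. -/
def A (n : ℕ) : ℕ := Nat.card {σ : Equiv.Perm (Fin n) // IsAlternating σ}

/-- The number `A₀(n)` of cyclically alternating permutations of `[n]`. -/
def A₀ (n : ℕ) : ℕ := Nat.card {σ : Equiv.Perm (Fin n) // IsCyclicallyAlternating σ}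

/-- `S(n) = ∑_{k ∈ ℤ} 1 / (4k + 1)^n`, for `n ≥ 2`, where the sum converges absolutely. -/
def S (n : ℕ) : ℝ := ∑' k : ℤ, 1 / (4 * (k : ℝ) + 1) ^ n

/-- The probability that a uniformly random alternating permutation of `[n]` is cyclically
alternating. -/
def probCyclic (n : ℕ) : ℝ :=
  letI : MeasurableSpace (Equiv.Perm (Fin n)) := ⊤
  (ProbabilityTheory.uniformOn {σ : Equiv.Perm (Fin n) | IsAlternating σ}).real
    {σ | IsCyclicallyAlternating σ}

end AltPerm

end

/-!
Let `fₙ(x)` be the volume of the set of the points of the unit cube with `x > x₁ < x₂ > ⋯`, so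
that `fₙ(1) = A(n) / n!`. Integrating over `x₁` gives `fₙ₊₁(x) = ∫₀ˣ fₙ(1 - t) dt`, and the
eigenfunctions of this operator are `sin (λₖ x)`, where `λₖ = (4k + 1)π / 2`, with eigenvalues
`1 / λₖ`. Expanding `f₁(x) = x` in them gives `A(n) = 2 n! (2 / π)ⁿ⁺¹ S(n + 1)`. No integration is
needed: `n! fₙ` is a polynomial whose Bernstein coefficients are the Entringer numbers.

Rotating a cyclically alternating permutation of `[2m]` by an even number of positions preserves
the property, so each of the `m` possible positions of the maximum accounts for as many
permutations as the last one, where deleting the maximum leaves an arbitrary alternating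
permutation of `[2m - 1]`. Hence `A₀(2m) = m A(2m - 1)`.

The term `k = 0` vanishes in `S(2m) - S(2m + 1)`, so the term `k = -1` dominates and the difference
is asymptotic to `(4 / 3) 9⁻ᵐ`.
-/

namespace AltPerm

open Polynomial Real Finset

/-! ### Zigzag steps -/

/-- The inequality that an alternating sequence satisfies between its entries `x` and `y` at the
positions `i` and `i + 1`. -/
def ZigzagStep {α : Type*} [LT α] (i : ℕ) (x y : α) : Prop :=
  (Even i → x < y) ∧ (Odd i → y < x)

lemma zigzagStep_succ {α : Type*} [LT α] {i : ℕ} {x y : α} :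
    ZigzagStep (i + 1) x y ↔ ZigzagStep i y x := by
  simp only [ZigzagStep, Nat.even_add_one, Nat.odd_add_one, Nat.not_even_iff_odd,
    Nat.not_odd_iff_even, and_comm]

lemma zigzagStep_iff_of_strictMono {α β : Type*} [LinearOrder α] [Preorder β] {f : α → β}
    (hf : StrictMono f) {i : ℕ} {x y : α} : ZigzagStep i (f x) (f y) ↔ ZigzagStep i x y := by
  simp only [ZigzagStep, hf.lt_iff_lt]

lemma zigzagStep_iff_of_strictAnti {α β : Type*} [LinearOrder α] [Preorder β] {f : α → β}
    (hf : StrictAnti f) {i : ℕ} {x y : α} : ZigzagStep i (f x) (f y) ↔ ZigzagStep i y x := by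
  simp only [ZigzagStep, hf.lt_iff_gt]

lemma isAlternating_iff_zigzagStep {n : ℕ} {σ : Equiv.Perm (Fin (n + 1))} :
    IsAlternating σ ↔ ∀ i : Fin n, ZigzagStep i (σ i.castSucc) (σ i.succ) :=
  ⟨fun h i => h i (by omega), fun h i hi => h ⟨i, by omega⟩⟩

/-- The bijection from the permutations of `Fin n` to the permutations of `Fin (n + 1)` that send
`a` to `b`: the remaining points, on both sides, are relabelled in increasing order. -/
def insertPerm {n : ℕ} (a b : Fin (n + 1)) :
    Equiv.Perm (Fin n) ≃ {σ : Equiv.Perm (Fin (n + 1)) // σ a = b} :=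
  ((Equiv.refl _).equivCongr (finSuccAboveEquiv b)).trans <|
    (Equiv.optionSubtype b).symm.trans <|
      ((finSuccEquiv' a).symm.equivCongr (Equiv.refl _)).subtypeEquiv fun e => by simp

@[simp]
lemma insertPerm_apply_succAbove {n : ℕ} (a b : Fin (n + 1)) (τ : Equiv.Perm (Fin n)) (i : Fin n) :
    (insertPerm a b τ : Equiv.Perm (Fin (n + 1))) (a.succAbove i) = b.succAbove (τ i) := by
  simp [insertPerm, finSuccAboveEquiv_apply]

/-! ### Entringer numbers -/

/-- The Entringer number `E(n, k)`: it counts the down-up permutations of `{0, …, n}` that start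
with `k`. The down-up permutations are the reversals `i ↦ n - σ i` of the alternating ones. -/
noncomputable def entringer (n k : ℕ) : ℕ :=
  Nat.card {σ : Equiv.Perm (Fin (n + 1)) // (σ 0 : ℕ) = k ∧ IsAlternating (Fin.revPerm * σ)}

lemma isAlternating_revPerm_mul_insertPerm_zero {n : ℕ} (k : Fin (n + 2))
    (τ : Equiv.Perm (Fin (n + 1))) :
    IsAlternating (Fin.revPerm * (insertPerm 0 k τ : Equiv.Perm (Fin (n + 2)))) ↔
      (τ 0).castSucc < k ∧ IsAlternating τ := by
  have hzero : (insertPerm 0 k τ : Equiv.Perm (Fin (n + 2))) 0 = k := (insertPerm 0 k τ).2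
  have hsucc (i : Fin (n + 1)) :
      (insertPerm 0 k τ : Equiv.Perm (Fin (n + 2))) i.succ = k.succAbove (τ i) := by
    rw [← Fin.succAbove_zero_apply, insertPerm_apply_succAbove]
  simp only [isAlternating_iff_zigzagStep, Equiv.Perm.mul_apply, Fin.revPerm_apply]
  rw [Fin.forall_fin_succ]
  refine and_congr ?_ (forall_congr' fun i => ?_)
  · rw [zigzagStep_iff_of_strictAnti Fin.rev_strictAnti, Fin.castSucc_zero, hzero, hsucc,
      ← Fin.succAbove_lt_iff_castSucc_lt]
    simp [ZigzagStep]
  · rw [Fin.castSucc_succ, Fin.val_succ, zigzagStep_succ,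
      zigzagStep_iff_of_strictAnti Fin.rev_strictAnti, hsucc, hsucc,
      zigzagStep_iff_of_strictMono (Fin.strictMono_succAbove k)]

lemma entringer_succ {n k : ℕ} (hk : k ≤ n + 1) :
    entringer (n + 1) k =
      Nat.card {τ : Equiv.Perm (Fin (n + 1)) // (τ 0 : ℕ) < k ∧ IsAlternating τ} := by
  obtain ⟨k, rfl⟩ : ∃ k' : Fin (n + 2), (k' : ℕ) = k := ⟨⟨k, by omega⟩, rfl⟩
  simp only [entringer, Fin.val_inj]
  exact Nat.card_congr ((Equiv.subtypeSubtypeEquivSubtypeInter _ _).symm.trans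
    ((insertPerm 0 k).subtypeEquiv fun τ =>
      (isAlternating_revPerm_mul_insertPerm_zero k τ).symm).symm)

lemma entringer_succ_zero (n : ℕ) : entringer (n + 1) 0 = 0 := by
  simp [entringer_succ]

lemma entringer_succ_self (n : ℕ) : entringer (n + 1) (n + 1) = A (n + 1) := by
  simp only [entringer_succ le_rfl, Fin.is_lt, true_and, A]

lemma entringer_zero_zero : entringer 0 0 = 1 := by
  simp [entringer, isAlternating_iff_zigzagStep]

lemma entringer_sub {n k : ℕ} (hk : k ≤ n) :
    entringer n (n - k) =
      Nat.card {τ : Equiv.Perm (Fin (n + 1)) // (τ 0 : ℕ) = k ∧ IsAlternating τ} := by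
  refine Nat.card_congr ((Equiv.mulLeft Fin.revPerm).subtypeEquiv fun σ => ?_)
  simp only [Equiv.coe_mulLeft, Equiv.Perm.mul_apply, Fin.revPerm_apply, Fin.val_rev]
  exact and_congr_left fun _ => by omega

lemma entringer_succ_succ {n k : ℕ} (hk : k ≤ n) :
    entringer (n + 1) (k + 1) = entringer (n + 1) k + entringer n (n - k) := by
  classical
  rw [entringer_succ (by omega), entringer_succ (by omega), entringer_sub hk]
  simp only [Nat.lt_succ_iff_lt_or_eq, or_and_right, Nat.card_eq_fintype_card]
  refine Fintype.card_subtype_or_disjoint _ _ (Pi.disjoint_iff.2 fun τ => ?_)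
  rw [Prop.disjoint_iff]
  omega

/-! ### The Entringer polynomials -/

lemma derivative_sum_smul_bernsteinPolynomial {R : Type*} [CommRing R] (c : ℕ → R) (n : ℕ) :
    derivative (∑ k ∈ range (n + 2), c k • bernsteinPolynomial R (n + 1) k) =
      (n + 1) * ∑ k ∈ range (n + 1), (c (k + 1) - c k) • bernsteinPolynomial R n k := by
  have habel : ∑ k ∈ range (n + 1), c (k + 1) • bernsteinPolynomial R n (k + 1) +
      c 0 • bernsteinPolynomial R n 0 = ∑ k ∈ range (n + 1), c k • bernsteinPolynomial R n k := by
    rw [← sum_range_succ' (fun k => c k • bernsteinPolynomial R n k), sum_range_succ,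
      bernsteinPolynomial.eq_zero_of_lt R n.lt_succ_self, smul_zero, add_zero]
  rw [sum_range_succ', derivative_add, derivative_sum]
  simp only [Polynomial.derivative_smul, bernsteinPolynomial.derivative_succ_aux,
    bernsteinPolynomial.derivative_zero, sub_smul, sum_sub_distrib, ← habel]
  simp only [smul_eq_C_mul, mul_sub, sum_sub_distrib, mul_sum, mul_add, mul_left_comm,
    Nat.cast_succ, Nat.add_sub_cancel]
  ring

/-- The polynomial with Bernstein coefficients `E(n, 0), …, E(n, n)`. On `[0, 1]`, its value at `x`
is `n!` times the volume of the set of the points `(x₁, …, xₙ)` of the unit cube that satisfy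
`x > x₁ < x₂ > ⋯`. -/
noncomputable def entringerPolynomial (n : ℕ) : ℝ[X] :=
  ∑ k ∈ range (n + 1), (entringer n k : ℝ) • bernsteinPolynomial ℝ n k

lemma entringerPolynomial_one : entringerPolynomial 1 = X := by
  simp [entringerPolynomial, sum_range_succ, entringer_succ_zero, entringer_succ_succ,
    entringer_zero_zero, bernsteinPolynomial]

lemma entringerPolynomial_succ_eval_zero (n : ℕ) : (entringerPolynomial (n + 1)).eval 0 = 0 := by
  simp [entringerPolynomial, eval_finsetSum, bernsteinPolynomial.eval_at_0, entringer_succ_zero]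

lemma entringerPolynomial_succ_eval_one (n : ℕ) :
    (entringerPolynomial (n + 1)).eval 1 = A (n + 1) := by
  simp [entringerPolynomial, eval_finsetSum, bernsteinPolynomial.eval_at_1, entringer_succ_self]

lemma derivative_entringerPolynomial_succ (n : ℕ) :
    derivative (entringerPolynomial (n + 1)) = (n + 1) * (entringerPolynomial n).comp (1 - X) := by
  rw [entringerPolynomial, derivative_sum_smul_bernsteinPolynomial, entringerPolynomial,
    Polynomial.sum_comp, ← sum_range_reflect]
  congr 1
  refine sum_congr rfl fun k hk => ?_
  have hk : k ≤ n := by simpa [Nat.lt_succ_iff] using hk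
  rw [show n + 1 - 1 - k = n - k by omega, smul_comp, bernsteinPolynomial.flip _ _ _ hk,
    entringer_succ_succ (n.sub_le k), Nat.sub_sub_self hk, Nat.cast_add, add_sub_cancel_left]

/-! ### Cyclically alternating permutations -/

lemma isCyclicallyAlternating_iff {n : ℕ} (hn : Odd n) {σ : Equiv.Perm (Fin (n + 1))} :
    IsCyclicallyAlternating σ ↔ ∀ i : Fin (n + 1), ZigzagStep i (σ i) (σ (i + 1)) := by
  have hlast : ZigzagStep n (σ (Fin.last n)) (σ 0) ↔ σ 0 < σ (Fin.last n) := by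
    simp [ZigzagStep, hn]
  rw [Fin.forall_fin_succ', IsCyclicallyAlternating, isAlternating_iff_zigzagStep]
  simp only [Fin.coeSucc_eq_succ, Fin.val_castSucc, Fin.last_add_one, Fin.val_last, hlast]
  simp [hn.add_one, Fin.last]

lemma even_val_add {n : ℕ} (hn : Even n) (i j : Fin n) :
    Even ((i + j : Fin n) : ℕ) ↔ Even (i + j : ℕ) := by
  rw [Fin.val_add, Nat.even_iff, Nat.mod_mod_of_dvd _ hn.two_dvd, ← Nat.even_iff]

lemma zigzagStep_val_add {α : Type*} [LT α] {n : ℕ} (hn : Even n) {i j : Fin n}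
    (hj : Even (j : ℕ)) {x y : α} : ZigzagStep (i + j : Fin n) x y ↔ ZigzagStep i x y := by
  simp only [ZigzagStep, ← Nat.not_even_iff_odd, even_val_add hn, Nat.even_add, hj, iff_true]

lemma isCyclicallyAlternating_mul_addRight_iff {n : ℕ} (hn : Odd n) {σ : Equiv.Perm (Fin (n + 1))}
    {j : Fin (n + 1)} (hj : Even (j : ℕ)) :
    IsCyclicallyAlternating (σ * Equiv.addRight j) ↔ IsCyclicallyAlternating σ := by
  rw [isCyclicallyAlternating_iff hn, isCyclicallyAlternating_iff hn,
    ← (Equiv.addRight j).forall_congr_right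
      (q := fun i : Fin (n + 1) => ZigzagStep i (σ i) (σ (i + 1)))]
  refine forall_congr' fun i => ?_
  simp only [Equiv.Perm.mul_apply, Equiv.coe_addRight, zigzagStep_val_add hn.add_one hj,
    add_right_comm]

lemma isCyclicallyAlternating_insertPerm_last_iff {n : ℕ} (hn : Odd n) {τ : Equiv.Perm (Fin n)} :
    IsCyclicallyAlternating (insertPerm (Fin.last n) (Fin.last n) τ : Equiv.Perm (Fin (n + 1))) ↔
      IsAlternating τ := by
  obtain ⟨n, rfl⟩ := Nat.exists_eq_add_of_le' hn.pos
  have hlast : (insertPerm (Fin.last (n + 1)) (Fin.last (n + 1)) τ : Equiv.Perm (Fin (n + 2)))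
      (Fin.last (n + 1)) = Fin.last (n + 1) :=
    (insertPerm (Fin.last (n + 1)) (Fin.last (n + 1)) τ).2
  have hcast (i : Fin (n + 1)) :
      (insertPerm (Fin.last (n + 1)) (Fin.last (n + 1)) τ : Equiv.Perm (Fin (n + 2))) i.castSucc =
        (τ i).castSucc := by
    rw [← Fin.succAbove_last_apply, insertPerm_apply_succAbove, Fin.succAbove_last_apply]
  have hn' : Even n := by simpa [Nat.odd_add_one] using hn
  rw [isCyclicallyAlternating_iff hn, isAlternating_iff_zigzagStep, Fin.forall_fin_succ',
    Fin.forall_fin_succ']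
  simp only [Fin.coeSucc_eq_succ, Fin.succ_last, hlast, Fin.succ_castSucc, hcast, Fin.val_last,
    Fin.val_castSucc, zigzagStep_iff_of_strictMono Fin.strictMono_castSucc, Fin.last_add_one]
  rw [← Fin.castSucc_zero, hcast]
  simp [ZigzagStep, hn, hn', Fin.castSucc_lt_last]

lemma IsCyclicallyAlternating.odd_of_apply_eq_last {n : ℕ} (hn : Odd n)
    {σ : Equiv.Perm (Fin (n + 1))} (hσ : IsCyclicallyAlternating σ) {a : Fin (n + 1)}
    (ha : σ a = Fin.last n) : Odd (a : ℕ) := by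
  by_contra heven
  have hlt := ((isCyclicallyAlternating_iff hn).1 hσ a).1 (Nat.not_odd_iff_even.1 heven)
  exact (Fin.le_last _).not_gt (ha ▸ hlt)

lemma card_isCyclicallyAlternating_apply_eq_last {n : ℕ} (hn : Odd n) {a : Fin (n + 1)}
    (ha : Odd (a : ℕ)) :
    Nat.card {σ : Equiv.Perm (Fin (n + 1)) // σ a = Fin.last n ∧ IsCyclicallyAlternating σ} =
      A n := by
  have heven : Even ((a + 1 : Fin (n + 1)) : ℕ) := by
    obtain ⟨n, rfl⟩ := Nat.exists_eq_add_of_le' hn.pos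
    rw [even_val_add hn.add_one, Fin.val_one]
    exact ha.add_one
  have hrotate (σ : Equiv.Perm (Fin (n + 1))) :
      σ a = Fin.last n ∧ IsCyclicallyAlternating σ ↔
        (σ * Equiv.addRight (a + 1)) (Fin.last n) = Fin.last n ∧
          IsCyclicallyAlternating (σ * Equiv.addRight (a + 1)) := by
    rw [isCyclicallyAlternating_mul_addRight_iff hn heven, Equiv.Perm.mul_apply,
      Equiv.coe_addRight]
    simp only [add_left_comm _ a, Fin.last_add_one, add_zero]
  exact Nat.card_congr <|
    ((Equiv.mulRight (Equiv.addRight (a + 1))).subtypeEquiv hrotate).trans <|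
    (Equiv.subtypeSubtypeEquivSubtypeInter _ _).symm.trans
      ((insertPerm (Fin.last n) (Fin.last n)).subtypeEquiv fun τ =>
        (isCyclicallyAlternating_insertPerm_last_iff hn).symm).symm

lemma sum_range_two_mul_ite_odd {M : Type*} [AddCommMonoid M] (m : ℕ) (c : M) :
    ∑ i ∈ range (2 * m), (if Odd i then c else 0) = m • c := by
  induction m with
  | zero => simp
  | succ m ih => simp [Nat.mul_succ, sum_range_succ, ih, succ_nsmul, (even_two_mul m).add_one,
      Nat.not_odd_iff_even.2 (even_two_mul m)]

lemma A₀_two_mul_succ (m : ℕ) : A₀ (2 * m + 1 + 1) = (m + 1) * A (2 * m + 1) := by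
  have hn : Odd (2 * m + 1) := odd_two_mul_add_one m
  have hfiber (a : Fin (2 * m + 1 + 1)) :
      Nat.card {σ : {σ : Equiv.Perm (Fin (2 * m + 1 + 1)) // IsCyclicallyAlternating σ} //
        σ.1.symm (Fin.last _) = a} = if Odd (a : ℕ) then A (2 * m + 1) else 0 := by
    rw [Nat.card_congr (Equiv.subtypeSubtypeEquivSubtypeInter IsCyclicallyAlternating
      fun σ : Equiv.Perm (Fin (2 * m + 1 + 1)) => σ.symm (Fin.last _) = a)]
    simp only [Equiv.symm_apply_eq, eq_comm (a := Fin.last _),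
      and_comm (a := IsCyclicallyAlternating _)]
    split_ifs with ha
    · exact card_isCyclicallyAlternating_apply_eq_last hn ha
    · exact Nat.card_eq_zero.2 (.inl ⟨fun σ => ha (σ.2.2.odd_of_apply_eq_last hn σ.2.1)⟩)
  rw [A₀, ← Nat.card_congr (Equiv.sigmaFiberEquiv fun
    σ : {σ : Equiv.Perm (Fin (2 * m + 1 + 1)) // IsCyclicallyAlternating σ} =>
      σ.1.symm (Fin.last _)), Nat.card_sigma]
  simp only [hfiber]
  rw [Fin.sum_univ_eq_sum_range fun a => if Odd a then A (2 * m + 1) else 0]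
  exact sum_range_two_mul_ite_odd (m + 1) _

lemma real_uniformOn {Ω : Type*} [MeasurableSpace Ω] [MeasurableSingletonClass Ω] {s : Set Ω}
    (hs : s.Finite) (t : Set Ω) :
    (ProbabilityTheory.uniformOn s).real t = (s ∩ t).ncard / s.ncard := by
  have hcount {u : Set Ω} (hu : u.Finite) : MeasureTheory.Measure.count.real u = u.ncard := by
    rw [MeasureTheory.measureReal_def, MeasureTheory.Measure.count_apply hu.measurableSet,
      ← hu.cast_ncard_eq, ENat.toENNReal_coe, ENNReal.toReal_natCast]
  rw [MeasureTheory.measureReal_def, ProbabilityTheory.uniformOn,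
    ProbabilityTheory.cond_apply hs.measurableSet, ENNReal.toReal_mul, ENNReal.toReal_inv,
    ← MeasureTheory.measureReal_def, ← MeasureTheory.measureReal_def, hcount hs,
    hcount (hs.inter_of_left t), inv_mul_eq_div]

lemma probCyclic_eq (n : ℕ) : probCyclic n = A₀ n / A n := by
  have hinter : {σ : Equiv.Perm (Fin n) | IsAlternating σ} ∩ {σ | IsCyclicallyAlternating σ}
      = {σ | IsCyclicallyAlternating σ} := Set.inter_eq_right.2 fun σ hσ => hσ.1
  let _ : MeasurableSpace (Equiv.Perm (Fin n)) := ⊤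
  rw [probCyclic, real_uniformOn (Set.toFinite _), hinter]
  rfl

/-! ### The sine series -/

lemma four_mul_add_one_ne_zero (k : ℤ) : 4 * (k : ℝ) + 1 ≠ 0 :=
  mod_cast (by omega : 4 * k + 1 ≠ 0)

lemma summable_one_div_four_mul_add_one_pow {n : ℕ} (hn : 1 < n) :
    Summable fun k : ℤ => 1 / (4 * (k : ℝ) + 1) ^ n := by
  have hinj : Function.Injective fun k : ℤ => 4 * k + 1 := fun k l h => by simpa using h
  simpa [Function.comp_def] using (summable_one_div_int_pow.2 hn).comp_injective hinj

/-- The frequencies `(4k + 1)π / 2`, at which the sine is `1` and the cosine vanishes. -/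
noncomputable def freq (k : ℤ) : ℝ := (4 * (k : ℝ) + 1) * (π / 2)

lemma freq_eq (k : ℤ) : freq k = π / 2 + k * (2 * π) := by
  rw [freq]
  ring

lemma freq_ne_zero (k : ℤ) : freq k ≠ 0 :=
  mul_ne_zero (four_mul_add_one_ne_zero k) (by positivity)

lemma sin_freq (k : ℤ) : sin (freq k) = 1 := by
  rw [freq_eq, sin_add_int_mul_two_pi, sin_pi_div_two]

lemma cos_freq (k : ℤ) : cos (freq k) = 0 := by
  rw [freq_eq, cos_add_int_mul_two_pi, cos_pi_div_two]

lemma sin_freq_mul (k : ℤ) (x : ℝ) : sin (freq k * x) = cos (freq k * (1 - x)) := by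
  rw [mul_sub, mul_one, cos_sub, cos_freq, sin_freq, zero_mul, one_mul, zero_add]

lemma one_div_freq_pow (k : ℤ) (n : ℕ) :
    1 / freq k ^ n = (2 / π) ^ n * (1 / (4 * (k : ℝ) + 1) ^ n) := by
  rw [freq, ← inv_div π 2, mul_pow, inv_pow, one_div, mul_inv, one_div, mul_comm]

lemma summable_one_div_freq_pow {n : ℕ} (hn : 1 < n) : Summable fun k => 1 / freq k ^ n := by
  simp only [one_div_freq_pow]
  exact (summable_one_div_four_mul_add_one_pow hn).mul_left _

/-- The series `2 ∑ₖ sin (λₖ x) / λₖⁿ⁺¹` over the frequencies `λₖ`: the expansion, in the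
eigenfunctions of `f ↦ ∫₀ˣ f (1 - t) dt`, of the `n`-th iterate of this operator on `1`. -/
noncomputable def sineSeries (n : ℕ) (x : ℝ) : ℝ :=
  2 * ∑' k : ℤ, sin (freq k * x) / freq k ^ (n + 1)

lemma sineSeries_apply_zero (n : ℕ) : sineSeries n 0 = 0 := by
  simp [sineSeries]

lemma sineSeries_apply_one (n : ℕ) : sineSeries n 1 = 2 * ((2 / π) ^ (n + 1) * S (n + 1)) := by
  simp only [sineSeries, mul_one, sin_freq, one_div_freq_pow, tsum_mul_left, S]

lemma hasDerivAt_sineSeries_succ {n : ℕ} (hn : 1 ≤ n) (x : ℝ) :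
    HasDerivAt (sineSeries (n + 1)) (sineSeries n (1 - x)) x := by
  refine (hasDerivAt_tsum (g := fun k y => sin (freq k * y) / freq k ^ (n + 2))
    (g' := fun k y => sin (freq k * (1 - y)) / freq k ^ (n + 1))
    (u := fun k => |1 / freq k ^ (n + 1)|) (y₀ := 0)
    (summable_one_div_freq_pow (by omega)).abs (fun k y => ?_) (fun k y => ?_) ?_ x).const_mul 2
  · have hsin : HasDerivAt (fun y => sin (freq k * y)) (cos (freq k * y) * freq k) y := by
      simpa using ((hasDerivAt_id y).const_mul (freq k)).sin
    refine (hsin.div_const (freq k ^ (n + 2))).congr_deriv ?_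
    rw [sin_freq_mul, sub_sub_cancel, pow_succ _ (n + 1), mul_div_mul_right _ _ (freq_ne_zero k)]
  · rw [norm_eq_abs, abs_div, abs_div, abs_one]
    gcongr
    exact abs_sin_le_one _
  · simp [summable_zero]

-- The enumeration `0, -1, 1, -2, 2, …` of `ℤ` turns `|4k + 1|` into `1, 3, 5, 7, 9, …`.
lemma hasSum_four_mul_add_one {M : Type*} [AddCommMonoid M] [TopologicalSpace M] {f : ℤ → M}
    (hf : f.Even) {a : M} (h : HasSum (fun n : ℕ => f (2 * n + 1)) a) :
    HasSum (fun k : ℤ => f (4 * k + 1)) a := by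
  rw [← Equiv.intEquivNat.hasSum_iff] at h
  convert h using 2 with k
  rcases k with n | n
  · have hk : Equiv.intEquivNat (Int.ofNat n) = 2 * n := rfl
    rw [Function.comp_apply, hk]
    congr 1
    push_cast [Int.ofNat_eq_natCast]
    ring
  · have hk : Equiv.intEquivNat (Int.negSucc n) = 2 * n + 1 := rfl
    rw [Function.comp_apply, hk, ← hf]
    congr 1
    push_cast [Int.negSucc_eq]
    ring

lemma hasSum_cos_nat_mul_div_sq {y : ℝ} (hy : y ∈ Set.Icc 0 2) :
    HasSum (fun n : ℕ => cos (n * (π * y)) / n ^ 2) (π ^ 2 * (y ^ 2 / 4 - y / 2 + 6⁻¹)) := by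
  have h := hasSum_one_div_nat_pow_mul_cos one_ne_zero (x := y / 2)
    ⟨by linarith [hy.1], by linarith [hy.2]⟩
  rw [← bernoulliFun, mul_one, bernoulliFun_two] at h
  convert h using 1
  · ext n
    rw [one_div_mul_eq_div]
    ring_nf
  · rw [Nat.factorial_two]
    push_cast
    ring

lemma hasSum_cos_odd_mul_div_sq {y : ℝ} (hy : y ∈ Set.Icc 0 1) :
    HasSum (fun n : ℕ => cos ((2 * n + 1) * (π * y)) / (2 * n + 1) ^ 2)
      (π ^ 2 / 8 * (1 - 2 * y)) := by
  let f (n : ℕ) : ℝ := cos (n * (π * y)) / n ^ 2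
  have hall : HasSum f _ := hasSum_cos_nat_mul_div_sq (y := y) ⟨hy.1, by linarith [hy.2]⟩
  have heven : HasSum (fun n : ℕ => f (2 * n)) (π ^ 2 * (y ^ 2 - y + 6⁻¹) / 4) := by
    convert! (hasSum_cos_nat_mul_div_sq (y := 2 * y)
      ⟨by linarith [hy.1], by linarith [hy.2]⟩).div_const 4 using 1
    · ext n
      simp only [f]
      push_cast
      ring_nf
    · ring
  have hodd : HasSum (fun n : ℕ => f (2 * n + 1)) (∑' n, f (2 * n + 1)) :=
    (hall.summable.comp_injective fun m n h => by simpa using h).hasSum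
  have hsplit := hall.unique (heven.even_add_odd hodd)
  convert hodd using 1
  · ext n
    simp [f]
  · linarith

lemma sineSeries_one {x : ℝ} (hx : x ∈ Set.Icc 0 1) : sineSeries 1 x = x := by
  let f : ℤ → ℝ := fun j => cos (j * (π * ((1 - x) / 2))) / j ^ 2
  have hf : f.Even := fun j => by simp [f]
  have h := hasSum_cos_odd_mul_div_sq (y := (1 - x) / 2)
    ⟨by linarith [hx.2], by linarith [hx.1]⟩
  have hsum := hasSum_four_mul_add_one hf (by simpa [f] using h)
  have hterm (k : ℤ) : sin (freq k * x) / freq k ^ 2 = (2 / π) ^ 2 * f (4 * k + 1) := by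
    rw [div_eq_mul_one_div, one_div_freq_pow, sin_freq_mul, freq]
    simp only [f]
    push_cast
    ring_nf
  simp only [sineSeries, hterm, tsum_mul_left, hsum.tsum_eq]
  field_simp
  ring

lemma entringerPolynomial_eval_eq_sineSeries {n : ℕ} (hn : 1 ≤ n) :
    ∀ x ∈ Set.Icc (0 : ℝ) 1, (entringerPolynomial n).eval x = n.factorial * sineSeries n x := by
  induction n, hn using Nat.le_induction with
  | base =>
    intro x hx
    rw [entringerPolynomial_one, eval_X, sineSeries_one hx, Nat.factorial_one, Nat.cast_one,
      one_mul]
  | succ n hn ih =>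
    have hseries (x : ℝ) (hx : x ∈ Set.Ico 0 1) : HasDerivAt
        (fun x => (n + 1).factorial * sineSeries (n + 1) x)
        ((derivative (entringerPolynomial (n + 1))).eval x) x := by
      refine ((hasDerivAt_sineSeries_succ hn x).const_mul _).congr_deriv ?_
      have hx' : 1 - x ∈ Set.Icc (0 : ℝ) 1 := ⟨by linarith [hx.2], by linarith [hx.1]⟩
      simp [derivative_entringerPolynomial_succ, ih (1 - x) hx', Nat.factorial_succ, mul_assoc]
    refine eq_of_has_deriv_right_eq
      (fun x _ => ((entringerPolynomial (n + 1)).hasDerivAt x).hasDerivWithinAt)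
      (fun x hx => (hseries x hx).hasDerivWithinAt) (entringerPolynomial (n + 1)).continuousOn ?_ ?_
    · exact fun x _ =>
        ((hasDerivAt_sineSeries_succ hn x).const_mul _).continuousAt.continuousWithinAt
    · rw [entringerPolynomial_succ_eval_zero, sineSeries_apply_zero, mul_zero]

lemma A_eq_S {n : ℕ} (hn : 1 ≤ n) :
    (A n : ℝ) = n.factorial * (2 * ((2 / π) ^ (n + 1) * S (n + 1))) := by
  rw [← sineSeries_apply_one, ← entringerPolynomial_eval_eq_sineSeries hn 1 (by simp)]
  obtain ⟨n, rfl⟩ := Nat.exists_eq_add_of_le' hn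
  exact (entringerPolynomial_succ_eval_one n).symm

lemma A₀_div_A_eq_mul {m : ℕ} (hm : 1 ≤ m) :
    (A₀ (2 * m) : ℝ) / A (2 * m) = m * (A (2 * m - 1) / A (2 * m)) := by
  obtain ⟨m, rfl⟩ := Nat.exists_eq_add_of_le' hm
  rw [← mul_div_assoc, show 2 * (m + 1) = 2 * m + 1 + 1 by ring, A₀_two_mul_succ,
    Nat.add_sub_cancel]
  push_cast
  rfl

lemma A₀_div_A_eq_S_div_S {m : ℕ} (hm : 1 ≤ m) :
    (A₀ (2 * m) : ℝ) / A (2 * m) = π / 4 * (S (2 * m) / S (2 * m + 1)) := by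
  rw [A₀_div_A_eq_mul hm, A_eq_S (by omega : 1 ≤ 2 * m - 1), A_eq_S (by omega : 1 ≤ 2 * m),
    Nat.sub_add_cancel (by omega : 1 ≤ 2 * m), ← Nat.mul_factorial_pred (by omega : 2 * m ≠ 0)]
  simp only [mul_div_mul_comm, ← mul_assoc]
  congr 1
  rw [pow_succ]
  push_cast
  field_simp
  norm_num

/-! ### Asymptotics -/

lemma tendsto_tsum_mul_pow {ι 𝕜 : Type*} [NormedField 𝕜] [CompleteSpace 𝕜] {w r : ι → 𝕜} {i₀ : ι}
    {N : ℕ} (hsum : Summable fun i => ‖w i * r i ^ N‖) (h₀ : r i₀ = 1)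
    (hlt : ∀ i ≠ i₀, w i ≠ 0 → ‖r i‖ < 1) :
    Tendsto (fun n => ∑' i, w i * r i ^ n) atTop (𝓝 (w i₀)) := by
  classical
  have hlim (i : ι) : Tendsto (fun n => w i * r i ^ n) atTop (𝓝 (if i = i₀ then w i₀ else 0)) := by
    split_ifs with hi
    · simp [hi, h₀]
    · rcases eq_or_ne (w i) 0 with hw | hw
      · simp [hw]
      · simpa using (tendsto_pow_atTop_nhds_zero_of_norm_lt_one (hlt i hi hw)).const_mul (w i)
  rw [← tsum_ite_eq i₀ fun _ => w i₀]
  refine tendsto_tsum_of_dominated_convergence hsum hlim ?_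
  filter_upwards [eventually_ge_atTop N] with n hn i
  rcases eq_or_ne (w i) 0 with hw | hw
  · simp [hw]
  have hle : ‖r i‖ ≤ 1 := by
    rcases eq_or_ne i i₀ with rfl | hi
    · simp [h₀]
    · exact (hlt i hi hw).le
  rw [norm_mul, norm_mul, norm_pow, norm_pow]
  gcongr ‖w i‖ * ?_
  exact pow_le_pow_of_le_one (norm_nonneg _) hle hn

lemma tendsto_S : Tendsto S atTop (𝓝 1) := by
  have h := tendsto_tsum_mul_pow (w := fun _ : ℤ => (1 : ℝ)) (r := fun k => 1 / (4 * (k : ℝ) + 1))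
    (i₀ := 0) (N := 2) ?_ (by simp) fun k hk _ => ?_
  · simpa only [S, one_mul, one_div_pow] using! h
  · simpa using (summable_one_div_four_mul_add_one_pow one_lt_two).abs
  · have : (1 : ℝ) < |4 * (k : ℝ) + 1| := mod_cast (by grind : 1 < |4 * k + 1|)
    rw [norm_eq_abs, abs_div, abs_one, div_lt_one (by positivity)]
    exact this

lemma tendsto_S_two_mul_add_one : Tendsto (fun m => S (2 * m + 1)) atTop (𝓝 1) :=
  tendsto_S.comp (tendsto_atTop_mono (fun m => (by omega : m ≤ 2 * m + 1)) tendsto_id)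

lemma nine_pow_mul_S_sub_S {m : ℕ} (hm : 1 ≤ m) :
    9 ^ m * (S (2 * m) - S (2 * m + 1)) =
      ∑' k : ℤ, 4 * (k : ℝ) / (4 * k + 1) * (9 / (4 * k + 1) ^ 2) ^ m := by
  rw [S, S, ← (summable_one_div_four_mul_add_one_pow (by omega)).tsum_sub
    (summable_one_div_four_mul_add_one_pow (by omega)), ← tsum_mul_left]
  refine tsum_congr fun k => ?_
  have hk := four_mul_add_one_ne_zero k
  rw [div_pow, ← pow_mul]
  field_simp
  ring

lemma tendsto_nine_pow_mul_S_sub_S :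
    Tendsto (fun m : ℕ => 9 ^ m * (S (2 * m) - S (2 * m + 1))) atTop (𝓝 (4 / 3)) := by
  have h := tendsto_tsum_mul_pow (w := fun k : ℤ => 4 * (k : ℝ) / (4 * k + 1))
    (r := fun k => 9 / (4 * (k : ℝ) + 1) ^ 2) (i₀ := -1) (N := 1) ?_ (by norm_num)
    fun k hk hw => ?_
  · norm_num at h
    refine h.congr' ?_
    filter_upwards [eventually_ge_atTop 1] with m hm using (nine_pow_mul_S_sub_S hm).symm
  · have hterm (k : ℤ) : 4 * (k : ℝ) / (4 * k + 1) * (9 / (4 * k + 1) ^ 2) ^ 1 =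
        9 * (1 / (4 * (k : ℝ) + 1) ^ 2 - 1 / (4 * (k : ℝ) + 1) ^ 3) := by
      have hk := four_mul_add_one_ne_zero k
      field_simp
      ring
    simp only [hterm]
    exact (((summable_one_div_four_mul_add_one_pow (by norm_num)).sub
      (summable_one_div_four_mul_add_one_pow (by norm_num))).mul_left 9).norm
  · have hk0 : k ≠ 0 := by rintro rfl; simp at hw
    have habs : |(3 : ℤ)| < |4 * k + 1| := by grind
    have : (9 : ℝ) < (4 * (k : ℝ) + 1) ^ 2 := by exact_mod_cast sq_lt_sq.2 habs
    rw [norm_eq_abs, abs_of_pos (by positivity), div_lt_one (by positivity)]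
    exact this

lemma tendsto_A₀_div_A :
    Tendsto (fun m : ℕ => (A₀ (2 * m) : ℝ) / A (2 * m)) atTop (𝓝 (π / 4)) := by
  have hS : Tendsto (fun m => S (2 * m)) atTop (𝓝 1) :=
    tendsto_S.comp (tendsto_id.const_mul_atTop' two_pos)
  have hlim := (hS.div tendsto_S_two_mul_add_one one_ne_zero).const_mul (π / 4)
  rw [div_one, mul_one] at hlim
  refine hlim.congr' ?_
  filter_upwards [eventually_ge_atTop 1] with m hm using (A₀_div_A_eq_S_div_S hm).symm

lemma isEquivalent_A₀_div_A_sub :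
    (fun m : ℕ => (A₀ (2 * m) : ℝ) / A (2 * m) - π / 4)
      ~[atTop] fun m : ℕ => π / 3 * (3 : ℝ) ^ (-(2 * (m : ℤ))) := by
  have hlim : Tendsto (fun m : ℕ => 3 / 4 * (9 ^ m * (S (2 * m) - S (2 * m + 1)) / S (2 * m + 1)))
      atTop (𝓝 (3 / 4 * (4 / 3 / 1))) :=
    (tendsto_nine_pow_mul_S_sub_S.div tendsto_S_two_mul_add_one one_ne_zero).const_mul _
  refine isEquivalent_of_tendsto_one (Tendsto.congr' ?_ (by simpa using hlim))
  filter_upwards [eventually_ge_atTop 1, tendsto_S_two_mul_add_one.eventually_ne one_ne_zero]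
    with m hm hS
  have hpow : (3 : ℝ) ^ (-(2 * (m : ℤ))) = (9 ^ m)⁻¹ := by
    rw [zpow_neg, zpow_mul]
    norm_num
  rw [Pi.div_apply, A₀_div_A_eq_S_div_S hm, hpow]
  field_simp

end AltPerm

theorem mainTheorem8 :
    (∀ m : ℕ, 1 ≤ m →
      Summable (fun k : ℤ => 1 / (4 * (k : ℝ) + 1) ^ (2 * m)) ∧
      Summable (fun k : ℤ => 1 / (4 * (k : ℝ) + 1) ^ (2 * m + 1)) ∧
      (AltPerm.A₀ (2 * m) : ℝ) / AltPerm.A (2 * m)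
        = m * ((AltPerm.A (2 * m - 1) : ℝ) / AltPerm.A (2 * m)) ∧
      (AltPerm.A₀ (2 * m) : ℝ) / AltPerm.A (2 * m)
        = Real.pi / 4 * (AltPerm.S (2 * m) / AltPerm.S (2 * m + 1)) ∧
      AltPerm.probCyclic (2 * m) = (AltPerm.A₀ (2 * m) : ℝ) / AltPerm.A (2 * m)) ∧
    Tendsto (fun m : ℕ => (AltPerm.A₀ (2 * m) : ℝ) / AltPerm.A (2 * m)) atTop
      (𝓝 (Real.pi / 4)) ∧
    Tendsto (fun m : ℕ => AltPerm.probCyclic (2 * m)) atTop (𝓝 (Real.pi / 4)) ∧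
    ∃ c : ℝ, 0 < c ∧
      (fun m : ℕ => AltPerm.probCyclic (2 * m) - Real.pi / 4)
        ~[atTop] (fun m : ℕ => c * (3 : ℝ) ^ (-(2 * (m : ℤ)))) := by
  refine ⟨fun m hm => ⟨AltPerm.summable_one_div_four_mul_add_one_pow (by omega),
    AltPerm.summable_one_div_four_mul_add_one_pow (by omega), AltPerm.A₀_div_A_eq_mul hm,
    AltPerm.A₀_div_A_eq_S_div_S hm, AltPerm.probCyclic_eq _⟩, AltPerm.tendsto_A₀_div_A, ?_,
    Real.pi / 3, by positivity, ?_⟩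
  · simpa only [AltPerm.probCyclic_eq] using AltPerm.tendsto_A₀_div_A
  · simpa only [AltPerm.probCyclic_eq] using AltPerm.isEquivalent_A₀_div_A_sub
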